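/- Let $(\mathcal S,\mathcal T,\mathcal A,\mathcal O,\mathcal Z,b_0,R,\gamma)$ be a POMDP with finite sets of states, actions and observations: row-stochastic transition matrices $T^a$ $(a\in\mathcal A)$, diagonal observation matrices $O^{ao}$ with $O^{ao}_{ii}=\mathbb P(o_t=o\mid s_t=s^i,a_t=a)$ (the emission probability when leaving $s^i$ under $a$), and initial distribution $b_0$. For an initial distribution $b$ and finite (possibly empty) action-observation strings $h=(a_1,o_1,\dots,a_t,o_t)$ and $\tau=(a_{t+1},o_{t+1},\dots,a_m,o_m)$, put $$F^b_{h,:}=b\,O^{a_1o_1}T^{a_1}\cdots O^{a_to_t}T^{a_t},\qquad B_{:,\tau}=O^{a_{t+1}o_{t+1}}T^{a_{t+1}}\cdots O^{a_mo_m}T^{a_m}\mathbf 1,\qquad H^b=F^bB,$$ the forward, backward and Hankel matrices of the POMDP with initial distribution $b$. Let $(s_t,a_t,o_t)_{t\ge1}$ be a run of the POMDP from $s_1\sim b_0$ in which the actions are drawn independently of the past with $a_t\sim\mathrm{Unif}(\mathcal A)$, and let $\mathcal D_n=(a_1,o_1,\dots,a_n,o_n)$. The suffix-history estimate is, with $L$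 the length of the concatenation $h\oplus\tau$, $$\hat H^{(n)}_{h,\tau}=\frac{\sum_{i=1}^{n-L}\mathbb I[(a_i,o_i,\dots,a_{i+L-1},o_{i+L-1})=h\oplus\tau]}{\sum_{i=1}^{n-L}\mathbb I[(a_i,\dots,a_{i+L-1})=\mathrm{acts}(h\oplus\tau)]},$$ where $\mathrm{acts}$ extracts the action sequence. Assume that the induced Markov chain $(s_t,a_t,o_t)$ on $\{(s,a,o):\mathbb P(o\mid s,a)>0\}$ is ergodic (irreducible and aperiodic). Then it has exactly one stationary distribution $p_\pi$; let $b_\pi(s)=\sum_{a,o}p_\pi(s,a,o)$. Let $N,M\in\mathbb N\cup\{\infty\}$ be the maximal lengths of histories and tests, and assume moreover that $F^{b_\pi}$ restricted to histories of length at most $N-1$, and $B$ restricted to tests of length at most $M$, both have rank $|\mathcal S|$. Then, almost surely, $\hat H^{(n)}_{h,\tau}\to H^{b_\pi}_{h,\tau}$ as $n\to\infty$ for all $h$ and $\tau$; that is, the limit is the Hankel matrix of the POMDP $(\mathcal S,\mathcal T,\mathcal A,\mathcal O,\mathcal Z,b_\pi,R,\gamma)$. The matrix $H^{b_\pi}$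 restricted to histories of length at most $N$ and tests of length at most $M$ (to all histories and tests if $N=M=\infty$) has rank $|\mathcal S|$. -/

import Mathlib

open MeasureTheory Filter Topology

/-- A discrete POMDP `(S, T, A, O, Z, b₀, R, γ)` with finite sets `S` of states, `A` of actions and
`O` of observations. -/
structure POMDP (S A O : Type*) [Fintype S] [Fintype A] [Fintype O] where
  /-- `T a i j` is the probability to move to the state `j` from the state `i` under the action `a`. -/
  T : A → Matrix S S ℝ
  T_mem : ∀ a i, (fun j => T a i j) ∈ stdSimplex ℝ S
  /-- `Obs a i z` is the probability to emit `z` when leaving the state `i` under the action `a`. -/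
  Obs : A → S → O → ℝ
  Obs_mem : ∀ a i, Obs a i ∈ stdSimplex ℝ O
  /-- The distribution of the initial state. -/
  b₀ : S → ℝ
  b₀_mem : b₀ ∈ stdSimplex ℝ S
  /-- The reward function. -/
  R : S → A → ℝ
  /-- The discount factor. -/
  γ : ℝ
  γ_mem : γ ∈ Set.Ioo (0 : ℝ) 1

namespace POMDP

variable {S A O : Type*} [Fintype S] [Fintype A] [Fintype O]

/-- The same POMDP with initial distribution `b`. -/
def withInit (P : POMDP S A O) (b : S → ℝ) (hb : b ∈ stdSimplex ℝ S) : POMDP S A O :=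
  { P with b₀ := b, b₀_mem := hb }

/-! Forward, backward and Hankel matrices. Histories and tests are finite action-observation
strings, the empty string included. -/

open Classical in
/-- The diagonal observation matrix `O^{ao}`. -/
noncomputable def obsDiag (P : POMDP S A O) (a : A) (z : O) : Matrix S S ℝ :=
  Matrix.diagonal fun i => P.Obs a i z

open Classical in
/-- `O^{a₁o₁} T^{a₁} ⋯ O^{aₙoₙ} T^{aₙ}` for the string `w = (a₁, o₁, …, aₙ, oₙ)`. -/
noncomputable def stringMatrix (P : POMDP S A O) (w : List (A × O)) : Matrix S S ℝ :=
  (w.map fun x => P.obsDiag x.1 x.2 * P.T x.1).prod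

/-- The row of a history is `b₀ O^{a₁o₁} T^{a₁} ⋯ O^{aₜoₜ} T^{aₜ}`. -/
noncomputable def forward (P : POMDP S A O) : Matrix (List (A × O)) S ℝ :=
  Matrix.of fun hist => Matrix.vecMul P.b₀ (P.stringMatrix hist)

/-- The column of a test is `O^{a₁o₁} T^{a₁} ⋯ O^{aₘoₘ} T^{aₘ} 𝟙`. -/
noncomputable def backward (P : POMDP S A O) : Matrix S (List (A × O)) ℝ :=
  Matrix.of fun i test => (P.stringMatrix test).mulVec 1 i

/-- The Hankel matrix, indexed by all histories and all tests. -/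
noncomputable def hankel (P : POMDP S A O) : Matrix (List (A × O)) (List (A × O)) ℝ :=
  P.forward * P.backward

/-- The forward matrix restricted to the histories that are at least one step shorter than the
maximal length `N` (all histories if `N = ⊤`). -/
noncomputable def shortForward (P : POMDP S A O) (N : ℕ∞) :
    Matrix {w : List (A × O) // (w.length : ℕ∞) + 1 ≤ N} S ℝ :=
  P.forward.submatrix Subtype.val id

/-- The backward matrix restricted to the tests of length at most `M` (all tests if `M = ⊤`). -/
noncomputable def backwardUpTo (P : POMDP S A O) (M : ℕ∞) :
    Matrix S {w : List (A × O) // (w.length : ℕ∞) ≤ M} ℝ :=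
  P.backward.submatrix id Subtype.val

/-- The Hankel matrix restricted to histories of length at most `N` and tests of length at most
`M`; for `N = M = ⊤` these are all histories and tests. -/
noncomputable def hankelUpTo (P : POMDP S A O) (N M : ℕ∞) :
    Matrix {w : List (A × O) // (w.length : ℕ∞) ≤ N} {w : List (A × O) // (w.length : ℕ∞) ≤ M} ℝ :=
  P.hankel.submatrix Subtype.val Subtype.val

/-! The Markov chain `(sₜ, aₜ, oₜ)` under the uniform memoryless exploration policy. -/

/-- The state space of the induced chain: triples `(s, a, o)` in which `o` has positive probability
given `s` and `a`. -/
abbrev ChainState (P : POMDP S A O) : Type _ := {x : S × A × O // 0 < P.Obs x.2.1 x.1 x.2.2}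

/-- The transition matrix of the induced chain: the state moves according to the last action, a new
action is drawn uniformly, and an observation is emitted. -/
noncomputable def chainMatrix (P : POMDP S A O) : Matrix P.ChainState P.ChainState ℝ :=
  Matrix.of fun x y =>
    P.T x.1.2.1 x.1.1 y.1.1 * ((Fintype.card A : ℝ)⁻¹ * P.Obs y.1.2.1 y.1.1 y.1.2.2)

open Classical in
/-- The induced chain is ergodic: irreducible, and every period is one. -/
def IsErgodic (P : POMDP S A O) : Prop :=
  P.chainMatrix.IsIrreducible ∧
    ∀ (x : P.ChainState) (d : ℕ),
      (∀ n : ℕ, 0 < n → 0 < (P.chainMatrix ^ n) x x → d ∣ n) → d = 1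

/-- `p` is a stationary distribution of the induced chain. -/
def IsStationary (P : POMDP S A O) (p : P.ChainState → ℝ) : Prop :=
  p ∈ stdSimplex ℝ P.ChainState ∧ Matrix.vecMul p P.chainMatrix = p

lemma sum_chainState (P : POMDP S A O) (g : S → A → O → ℝ) :
    ∑ y : P.ChainState, g y.1.1 y.1.2.1 y.1.2.2 * P.Obs y.1.2.1 y.1.1 y.1.2.2
      = ∑ i, ∑ a, ∑ z, g i a z * P.Obs a i z := by
  classical
  have h1 : ∑ i, ∑ a, ∑ z, g i a z * P.Obs a i z
      = ∑ x : S × A × O, g x.1 x.2.1 x.2.2 * P.Obs x.2.1 x.1 x.2.2 := by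
    simp only [Fintype.sum_prod_type]
  rw [h1, ← Finset.sum_filter_add_sum_filter_not Finset.univ
    (fun x : S × A × O => 0 < P.Obs x.2.1 x.1 x.2.2)]
  rw [Finset.sum_eq_zero (s := Finset.univ.filter
    (fun x : S × A × O => ¬ 0 < P.Obs x.2.1 x.1 x.2.2)), add_zero]
  · symm
    apply Finset.sum_subtype (p := fun x : S × A × O => 0 < P.Obs x.2.1 x.1 x.2.2)
    simp
  · intro x hx
    have h0 := (P.Obs_mem x.2.1 x.1).1 x.2.2
    have : P.Obs x.2.1 x.1 x.2.2 = 0 := le_antisymm (not_lt.1 (Finset.mem_filter.1 hx).2) h0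
    simp [this]

lemma chainMatrix_nonneg (P : POMDP S A O) (x y : P.ChainState) : 0 ≤ P.chainMatrix x y :=
  mul_nonneg ((P.T_mem _ _).1 _) (mul_nonneg (by positivity) y.2.le)

lemma chainMatrix_row_sum [Nonempty A] (P : POMDP S A O) (x : P.ChainState) :
    ∑ y, P.chainMatrix x y = 1 := by
  have h := P.sum_chainState fun i _ _ => P.T x.1.2.1 x.1.1 i * (Fintype.card A : ℝ)⁻¹
  have h2 : ∑ y, P.chainMatrix x y = ∑ y : P.ChainState,
      P.T x.1.2.1 x.1.1 y.1.1 * (Fintype.card A : ℝ)⁻¹ * P.Obs y.1.2.1 y.1.1 y.1.2.2 :=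
    Finset.sum_congr rfl fun y _ => by simp [chainMatrix, mul_assoc]
  rw [h2, h]
  have hA : (Fintype.card A : ℝ) ≠ 0 := by simp
  simp only [← Finset.mul_sum, (P.Obs_mem _ _).2, mul_one, Finset.sum_const, Finset.card_univ,
    nsmul_eq_mul]
  calc _ = ∑ i, P.T x.1.2.1 x.1.1 i := Finset.sum_congr rfl fun i _ => by field_simp
    _ = 1 := (P.T_mem _ _).2

lemma nonempty_chainState [Nonempty A] (P : POMDP S A O) : Nonempty P.ChainState := by
  by_contra hne
  rw [not_nonempty_iff] at hne
  have hS : Nonempty S := by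
    by_contra h
    rw [not_nonempty_iff] at h
    simpa using P.b₀_mem.2
  obtain ⟨i⟩ := hS
  have a := Classical.arbitrary A
  have h0 : ∀ z, P.Obs a i z = 0 := fun z =>
    le_antisymm (not_lt.1 fun h => hne.elim ⟨(i, a, z), h⟩) ((P.Obs_mem a i).1 z)
  simpa [h0] using (P.Obs_mem a i).2

lemma exists_isStationary [Nonempty A] (P : POMDP S A O) : ∃ p, P.IsStationary p := by
  classical
  have := P.nonempty_chainState
  set K := P.chainMatrix with hK
  obtain ⟨v, hv0, hv⟩ : ∃ v, v ≠ 0 ∧ Matrix.vecMul v (K - 1) = 0 := by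
    rw [Matrix.exists_vecMul_eq_zero_iff, ← Matrix.exists_mulVec_eq_zero_iff]
    refine ⟨1, one_ne_zero, ?_⟩
    ext x
    have h : K.mulVec 1 x = 1 := by
      simp only [Matrix.mulVec, dotProduct, Pi.one_apply, mul_one]
      exact P.chainMatrix_row_sum x
    rw [Matrix.sub_mulVec, Matrix.one_mulVec, Pi.sub_apply, h, Pi.one_apply, sub_self, Pi.zero_apply]
  have hvK : Matrix.vecMul v K = v := by
    rw [Matrix.vecMul_sub, Matrix.vecMul_one, sub_eq_zero] at hv
    exact hv
  have hle : ∀ y ∈ Finset.univ, |v y| ≤ ∑ x, |v x| * K x y := fun y _ => by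
    have h : v y = ∑ x, v x * K x y := (congrFun hvK y).symm
    calc |v y| = |∑ x, v x * K x y| := by rw [← h]
      _ ≤ ∑ x, |v x * K x y| := Finset.abs_sum_le_sum_abs _ _
      _ = ∑ x, |v x| * K x y := Finset.sum_congr rfl fun x _ => by
        rw [abs_mul, abs_of_nonneg (P.chainMatrix_nonneg x y)]
  have hsum : ∑ y, |v y| = ∑ y, ∑ x, |v x| * K x y := by
    rw [Finset.sum_comm]
    exact Finset.sum_congr rfl fun x _ => by rw [← Finset.mul_sum, P.chainMatrix_row_sum, mul_one]
  have heq := (Finset.sum_eq_sum_iff_of_le hle).1 hsum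
  have hpos : 0 < ∑ y, |v y| := by
    obtain ⟨x, hx⟩ := Function.ne_iff.1 hv0
    exact Finset.sum_pos' (fun _ _ => abs_nonneg _) ⟨x, Finset.mem_univ _, abs_pos.2 hx⟩
  refine ⟨fun x => |v x| / ∑ y, |v y|, ⟨fun x => by positivity, ?_⟩, ?_⟩
  · rw [← Finset.sum_div, div_self hpos.ne']
  · ext y
    simp only [Matrix.vecMul, dotProduct]
    rw [heq y (Finset.mem_univ y), Finset.sum_div]
    exact Finset.sum_congr rfl fun x _ => by rw [div_mul_eq_mul_div]

/-- The stationary distribution `p_π` of the induced chain (there is always one, and under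
ergodicity only one). -/
noncomputable def stationaryDist [Nonempty A] (P : POMDP S A O) : P.ChainState → ℝ :=
  P.exists_isStationary.choose

open Classical in
/-- The marginal of a distribution of the induced chain on the states of the POMDP. -/
noncomputable def stateMarginal (P : POMDP S A O) (p : P.ChainState → ℝ) (i : S) : ℝ :=
  ∑ x : P.ChainState, if x.1.1 = i then p x else 0

lemma stateMarginal_mem (P : POMDP S A O) {p : P.ChainState → ℝ}
    (hp : p ∈ stdSimplex ℝ P.ChainState) : P.stateMarginal p ∈ stdSimplex ℝ S := by
  classical
  refine ⟨fun i => Finset.sum_nonneg fun x _ => ?_, ?_⟩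
  · split_ifs
    exacts [hp.1 x, le_rfl]
  · unfold stateMarginal
    rw [Finset.sum_comm]
    simpa using hp.2

/-- The POMDP with initial distribution `b_π`, the state marginal of the stationary distribution. -/
noncomputable def atStationarity [Nonempty A] (P : POMDP S A O) : POMDP S A O :=
  P.withInit (P.stateMarginal P.stationaryDist)
    (P.stateMarginal_mem P.exists_isStationary.choose_spec.1)

/-- The process `(s t, a t, o t)`, `t = 0, 1, 2, …`, is a run of the POMDP in which the actions are
drawn uniformly and independently of the past: `s 0` has law `b₀`, and the probability of a finite
path is the product of the probabilities of its steps. -/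
structure IsTrajectory (P : POMDP S A O) {Ω : Type*} [MeasurableSpace Ω] (μ : Measure Ω)
    (s : ℕ → Ω → S) (a : ℕ → Ω → A) (o : ℕ → Ω → O) : Prop where
  measurable_s : ∀ t, Measurable[_, ⊤] (s t)
  measurable_a : ∀ t, Measurable[_, ⊤] (a t)
  measurable_o : ∀ t, Measurable[_, ⊤] (o t)
  law : ∀ (n : ℕ) (i : ℕ → S) (u : ℕ → A) (z : ℕ → O),
    μ.real {ω | ∀ t ≤ n, s t ω = i t ∧ a t ω = u t ∧ o t ω = z t} =
      P.b₀ (i 0) *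
        (∏ t ∈ Finset.range (n + 1), (Fintype.card A : ℝ)⁻¹ * P.Obs (u t) (i t) (z t)) *
        ∏ t ∈ Finset.range n, P.T (u t) (i t) (i (t + 1))

end POMDP

/-- The string of `L` action-observation pairs of the data `D` that starts at time `i`. -/
def window {A O : Type*} (D : ℕ → A × O) (i L : ℕ) : List (A × O) :=
  (List.range L).map fun j => D (i + j)

open Classical in
/-- The suffix-history estimate of the Hankel matrix from the first `n` pairs of `D`: among the
`n - L` windows of length `L = |hist ⊕ test|` counted, the number of those equal to `hist ⊕ test`,
divided by the number of those with the same actions as `hist ⊕ test`. -/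
noncomputable def empiricalHankel {A O : Type*} (D : ℕ → A × O) (n : ℕ) :
    Matrix (List (A × O)) (List (A × O)) ℝ :=
  Matrix.of fun hist test =>
    (∑ i ∈ Finset.range (n - (hist ++ test).length),
        if window D i (hist ++ test).length = hist ++ test then (1 : ℝ) else 0) /
      ∑ i ∈ Finset.range (n - (hist ++ test).length),
        if (window D i (hist ++ test).length).map Prod.fst = (hist ++ test).map Prod.fst
        then (1 : ℝ) else 0

/-! The estimate is a quotient of two averages along the data: how often a string `w` of length `L`
occurs, and how often its actions occur. Both are sums of products of functions of consecutive
pairs, so one strong law for such window products of a finite Markov chain, started anywhere, gives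
convergence (`ae_tendsto_average_windowProd`). For that law, first replace each window product by
its conditional mean given the chain at the start of the window; the errors are bounded, and
orthogonal at distance `L`. The conditional mean minus its stationary value has the form `g - K g`
(Poisson equation, solvable by irreducibility), and along the chain this is a martingale difference
plus a telescoping term. Averages of bounded orthogonal errors vanish almost surely by a
second-moment bound along squares (`ae_tendsto_average_of_orthogonal`). In stationarity, action and
observation are drawn afresh given the state, so the limits are `|A|⁻ᴸ ∑ b_π(i) B_{i,w}` and
`|A|⁻ᴸ`. Their quotient is the Hankel entry, since `F_h B_τ = b B_{h ⊕ τ}`. For the rank, a `B` of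
full row rank maps onto the state space, so `F B` has the column space of `F`; and `F` on histories
up to `N` contains the shorter ones, which already have full rank. -/

/-! ### Linear algebra: ranks of products and irreducible stochastic matrices -/

/-- The product of two matrices of full rank over a finite middle index has full rank. -/
lemma Matrix.eRank_mul_eq_card {m n k : Type*} [Fintype n] (F : Matrix m n ℝ) (B : Matrix n k ℝ)
    (hF : F.eRank = Fintype.card n) (hB : B.eRank = Fintype.card n) :
    (F * B).eRank = Fintype.card n := by
  have htop : Submodule.span ℝ (Set.range B.col) = ⊤ := by
    apply Submodule.eq_top_of_finrank_eq
    rw [← Matrix.eRank_toNat_eq_finrank, hB]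
    simp
  have hspan : Submodule.span ℝ (Set.range (F * B).col) = Submodule.span ℝ (Set.range F.col) := by
    have h1 : Set.range (F * B).col = F.mulVecLin '' Set.range B.col := by
      rw [← Set.range_comp]
      rfl
    rw [h1, Submodule.span_image, htop, Submodule.map_top, Matrix.range_mulVecLin]
  rw [← hF, Matrix.eRank, Matrix.eRank, Matrix.cRank, Matrix.cRank, hspan]

/-- A function that is harmonic for an irreducible stochastic matrix is constant. -/
lemma Matrix.IsIrreducible.eq_of_mulVec_eq {n : Type*} [Fintype n] {K : Matrix n n ℝ}
    (hK : K.IsIrreducible) (hrow : ∀ x, ∑ y, K x y = 1) {u : n → ℝ} (hu : K.mulVec u = u)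
    (x y : n) : u x = u y := by
  classical
  have key : ∀ v : n → ℝ, K.mulVec v = v → ∀ k : ℕ, (K ^ k).mulVec v = v := by
    intro v hv k
    induction k with
    | zero => simp
    | succ k ih => rw [pow_succ, ← Matrix.mulVec_mulVec, hv, ih]
  have hone : K.mulVec 1 = 1 := by
    ext x
    simpa [Matrix.mulVec, dotProduct] using hrow x
  have hnn : ∀ (k : ℕ) (i j : n), 0 ≤ (K ^ k) i j := by
    intro k
    induction k with
    | zero => intro i j; simp only [pow_zero, Matrix.one_apply]; split_ifs <;> norm_num
    | succ k ih =>
      intro i j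
      rw [pow_succ, Matrix.mul_apply]
      exact Finset.sum_nonneg fun l _ => mul_nonneg (ih i l) (hK.nonneg l j)
  have : Nonempty n := ⟨x⟩
  -- Maximum principle: at a maximum `m` the `K ^ k`-average of the nonnegative function `u m - u`
  -- is zero, so `u = u m` at every point reachable from `m`, hence everywhere.
  obtain ⟨m, hm⟩ := Finite.exists_max u
  suffices h : ∀ y, u y = u m by rw [h x, h y]
  intro y
  obtain ⟨k, -, hk⟩ := (Matrix.isIrreducible_iff_exists_pow_pos hK.nonneg).1 hK m y
  have h0 : ∑ z, (K ^ k) m z * (u m - u z) = 0 := by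
    have h1 := congrFun (key u hu k) m
    have h2 := congrFun (key 1 hone k) m
    simp only [Matrix.mulVec, dotProduct, Pi.one_apply, mul_one] at h1 h2
    simp only [mul_sub, Finset.sum_sub_distrib, h1, ← Finset.sum_mul, h2, one_mul, sub_self]
  have h1 := (Finset.sum_eq_zero_iff_of_nonneg
    (fun z _ => mul_nonneg (hnn k m z) (sub_nonneg.2 (hm z)))).1 h0 y (Finset.mem_univ y)
  rcases mul_eq_zero.1 h1 with h | h
  · exact absurd h hk.ne'
  · linarith

/-- The Poisson equation of an irreducible stochastic matrix is solvable for every function of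
stationary mean zero. -/
lemma Matrix.IsIrreducible.exists_poisson {n : Type*} [Fintype n] {K : Matrix n n ℝ}
    (hK : K.IsIrreducible) (hrow : ∀ x, ∑ y, K x y = 1) {p : n → ℝ} (hp1 : ∑ x, p x = 1)
    (hp : Matrix.vecMul p K = p) {f : n → ℝ} (hf : p ⬝ᵥ f = 0) :
    ∃ g : n → ℝ, f = g - K.mulVec g := by
  -- `1 - K` kills the constants. Adding the rank-one map `g ↦ (p ⬝ᵥ g) • 1` makes it injective,
  -- hence bijective; the added term vanishes on preimages of functions of mean zero, because `Φ`
  -- preserves the `p`-mean.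
  let Φ : (n → ℝ) →ₗ[ℝ] (n → ℝ) :=
    { toFun := fun g => g - K.mulVec g + (p ⬝ᵥ g) • 1
      map_add' := fun g h => by
        simp only [Matrix.mulVec_add, dotProduct_add, add_smul]; abel
      map_smul' := fun c g => by
        simp only [Matrix.mulVec_smul, dotProduct_smul, RingHom.id_apply, smul_eq_mul, mul_smul,
          smul_add, smul_sub] }
  have hΦ : ∀ g, Φ g = g - K.mulVec g + (p ⬝ᵥ g) • 1 := fun _ => rfl
  have hmean : ∀ g, p ⬝ᵥ Φ g = p ⬝ᵥ g := by
    intro g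
    have h1 : p ⬝ᵥ (1 : n → ℝ) = 1 := by rw [dotProduct_one, hp1]
    rw [hΦ, dotProduct_add, dotProduct_sub, Matrix.dotProduct_mulVec, hp, sub_self, zero_add,
      dotProduct_smul, h1, smul_eq_mul, mul_one]
  have hinj : Function.Injective Φ := by
    rw [injective_iff_map_eq_zero]
    intro g hg
    have h0 : p ⬝ᵥ g = 0 := by rw [← hmean, hg, dotProduct_zero]
    have hfix : K.mulVec g = g := by
      rw [hΦ, h0, zero_smul, add_zero, sub_eq_zero] at hg
      exact hg.symm
    ext x
    have hc : g = fun _ => g x := funext fun y => hK.eq_of_mulVec_eq hrow hfix y x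
    rw [hc] at h0
    simpa [dotProduct, ← Finset.sum_mul, hp1] using h0
  obtain ⟨g, hg⟩ := LinearMap.injective_iff_surjective.1 hinj f
  refine ⟨g, ?_⟩
  rw [← hg, hmean] at hf
  rw [← hg, hΦ, hf, zero_smul, add_zero]

/-- An irreducible stochastic matrix has at most one stationary distribution. -/
lemma Matrix.IsIrreducible.stationary_unique {n : Type*} [Fintype n] {K : Matrix n n ℝ}
    (hK : K.IsIrreducible) (hrow : ∀ x, ∑ y, K x y = 1) {p q : n → ℝ} (hp1 : ∑ x, p x = 1)
    (hp : Matrix.vecMul p K = p) (hq1 : ∑ x, q x = 1) (hq : Matrix.vecMul q K = q) : q = p := by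
  classical
  ext x
  -- The centred indicator of `x` lies in the range of `1 - K`, which every stationary `q`
  -- annihilates; hence `q x = p x`.
  obtain ⟨g, hg⟩ := hK.exists_poisson hrow hp1 hp (f := Pi.single x 1 - p x • (1 : n → ℝ)) (by
    rw [dotProduct_sub, dotProduct_smul, dotProduct_one, hp1]; simp)
  have h : q ⬝ᵥ (Pi.single x 1 - p x • (1 : n → ℝ)) = 0 := by
    rw [hg, dotProduct_sub, Matrix.dotProduct_mulVec, hq, sub_self]
  rw [dotProduct_sub, dotProduct_smul, dotProduct_one, hq1] at h
  simpa [sub_eq_zero] using h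

/-! ### A strong law for bounded sequences orthogonal at a distance -/

/-- The second moment of the partial sums of a bounded sequence whose members at distance at least
`L` are orthogonal grows at most linearly. -/
lemma integral_sq_sum_le {Ω : Type*} [MeasurableSpace Ω] {μ : Measure Ω} [IsProbabilityMeasure μ]
    {U : ℕ → Ω → ℝ} {C : ℝ} {L : ℕ} (hm : ∀ i, Measurable (U i)) (hC : ∀ i ω, |U i ω| ≤ C)
    (horth : ∀ i j, i + L ≤ j → ∫ ω, U i ω * U j ω ∂μ = 0) (n : ℕ) :
    ∫ ω, (∑ i ∈ Finset.range n, U i ω) ^ 2 ∂μ ≤ n * ((2 * L + 1) * C ^ 2) := by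
  have hprod : ∀ i j ω, |U i ω * U j ω| ≤ C ^ 2 := fun i j ω => by
    rw [abs_mul, sq]
    exact mul_le_mul (hC i ω) (hC j ω) (abs_nonneg _) ((abs_nonneg _).trans (hC i ω))
  have hint : ∀ i j, Integrable (fun ω => U i ω * U j ω) μ := fun i j =>
    Integrable.of_bound ((hm i).mul (hm j)).aestronglyMeasurable (C ^ 2)
      (Eventually.of_forall fun ω => hprod i j ω)
  have hle : ∀ i j, ∫ ω, U i ω * U j ω ∂μ ≤ C ^ 2 := fun i j => by
    have h : ∫ ω, U i ω * U j ω ∂μ ≤ ∫ _, C ^ 2 ∂μ :=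
      integral_mono (hint i j) (integrable_const _) fun ω => (le_abs_self _).trans (hprod i j ω)
    simpa using h
  -- A new term adds its square and twice its products with the earlier terms, at most `L` of which
  -- are not orthogonal to it; this gives the factor `2 * L + 1`.
  induction n with
  | zero => simp
  | succ n ih =>
    have hexp : ∀ ω, (∑ i ∈ Finset.range (n + 1), U i ω) ^ 2 =
        ((∑ i ∈ Finset.range n, U i ω) ^ 2 + 2 * ∑ i ∈ Finset.range n, U i ω * U n ω)
          + U n ω * U n ω := fun ω => by
      rw [Finset.sum_range_succ, ← Finset.sum_mul]; ring
    have hsq : Integrable (fun ω => (∑ i ∈ Finset.range n, U i ω) ^ 2) μ := by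
      simp_rw [sq, Finset.sum_mul_sum]
      exact integrable_finsetSum _ fun i _ => integrable_finsetSum _ fun j _ => hint i j
    have hcross : Integrable (fun ω => 2 * ∑ i ∈ Finset.range n, U i ω * U n ω) μ :=
      (integrable_finsetSum _ fun i _ => hint i n).const_mul 2
    have hsum : ∑ i ∈ Finset.range n, ∫ ω, U i ω * U n ω ∂μ ≤ L * C ^ 2 := by
      calc ∑ i ∈ Finset.range n, ∫ ω, U i ω * U n ω ∂μ
          ≤ ∑ i ∈ Finset.range n, if n - L ≤ i then C ^ 2 else 0 := by
            refine Finset.sum_le_sum fun i hi => ?_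
            have hin := Finset.mem_range.1 hi
            split_ifs with h
            · exact hle i n
            · exact (horth i n (by omega)).le
        _ = ((Finset.range n).filter fun i => n - L ≤ i).card * C ^ 2 := by
            rw [← Finset.sum_filter, Finset.sum_const, nsmul_eq_mul]
        _ ≤ L * C ^ 2 := by
            gcongr
            calc _ ≤ (Finset.Ico (n - L) n).card := Finset.card_le_card fun i hi => by
                  rw [Finset.mem_filter, Finset.mem_range] at hi
                  exact Finset.mem_Ico.2 ⟨hi.2, hi.1⟩
              _ ≤ L := by rw [Nat.card_Ico]; omega
    simp_rw [hexp]
    have hadd : Integrable (fun ω => (∑ i ∈ Finset.range n, U i ω) ^ 2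
        + 2 * ∑ i ∈ Finset.range n, U i ω * U n ω) μ := hsq.add hcross
    rw [integral_add hadd (hint n n), integral_add hsq hcross, integral_const_mul,
      integral_finsetSum _ fun i _ => hint i n]
    have := hle n n
    push_cast
    linarith

/-- Averages of a bounded sequence converge to `0` if they do so along the squares. -/
lemma tendsto_average_of_squares {u : ℕ → ℝ} {C : ℝ} (hC : ∀ i, |u i| ≤ C)
    (h : Tendsto (fun k : ℕ => (∑ i ∈ Finset.range (k ^ 2), u i) / (k : ℝ) ^ 2) atTop (𝓝 0)) :
    Tendsto (fun n : ℕ => (∑ i ∈ Finset.range n, u i) / n) atTop (𝓝 0) := by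
  have hC0 : 0 ≤ C := (abs_nonneg _).trans (hC 0)
  have hsqrt : Tendsto Nat.sqrt atTop atTop :=
    tendsto_atTop.2 fun b => (eventually_ge_atTop (b * b)).mono fun n hn => Nat.le_sqrt.2 hn
  have hlim : Tendsto (fun k : ℕ => |(∑ i ∈ Finset.range (k ^ 2), u i) / (k : ℝ) ^ 2|
      + 2 * C / k) atTop (𝓝 0) := by
    simpa using h.abs.add (tendsto_const_div_atTop_nhds_zero_nat (2 * C))
  -- With `k = √n` rounded down, at most `2 * k` terms lie between `k ^ 2` and `n`; divided by `k ^
  -- 2` they contribute at most `2 * C / k`.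
  refine squeeze_zero_norm' ?_ (hlim.comp hsqrt)
  filter_upwards [eventually_ge_atTop 1] with n hn
  set k := Nat.sqrt n with hk
  have hk1 : 1 ≤ k := Nat.le_sqrt.2 (by simpa using hn)
  have hkn : k ^ 2 ≤ n := Nat.sqrt_le' n
  have hnk : n ≤ k ^ 2 + 2 * k := by
    have := Nat.lt_succ_sqrt' n
    rw [← hk] at this
    have h2 : (k + 1) ^ 2 = k ^ 2 + 2 * k + 1 := by ring
    simp only [Nat.succ_eq_add_one] at this
    omega
  have hkpos : (0 : ℝ) < k := by exact_mod_cast hk1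
  have hnpos : (0 : ℝ) < n := by exact_mod_cast hn
  have hkn' : (k : ℝ) ^ 2 ≤ n := by exact_mod_cast hkn
  have hsplit : ∑ i ∈ Finset.range n, u i
      = ∑ i ∈ Finset.range (k ^ 2), u i + ∑ i ∈ Finset.Ico (k ^ 2) n, u i :=
    (Finset.sum_range_add_sum_Ico _ hkn).symm
  have hrest : |∑ i ∈ Finset.Ico (k ^ 2) n, u i| ≤ 2 * k * C := by
    calc _ ≤ ∑ i ∈ Finset.Ico (k ^ 2) n, |u i| := Finset.abs_sum_le_sum_abs _ _
      _ ≤ ∑ i ∈ Finset.Ico (k ^ 2) n, C := Finset.sum_le_sum fun i _ => hC i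
      _ = ((n - k ^ 2 : ℕ) : ℝ) * C := by simp
      _ ≤ 2 * k * C := by
        gcongr
        have : n - k ^ 2 ≤ 2 * k := by omega
        exact_mod_cast this
  rw [Real.norm_eq_abs, abs_div, abs_of_pos hnpos]
  simp only [Function.comp_apply, ← hk]
  calc |∑ i ∈ Finset.range n, u i| / n
      ≤ (|∑ i ∈ Finset.range (k ^ 2), u i| + 2 * k * C) / n := by
        rw [hsplit]; gcongr; exact (abs_add_le _ _).trans (by gcongr)
    _ ≤ (|∑ i ∈ Finset.range (k ^ 2), u i| + 2 * k * C) / (k : ℝ) ^ 2 := by gcongr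
    _ = _ := by
        rw [abs_div, abs_of_pos (by positivity : (0 : ℝ) < (k : ℝ) ^ 2)]
        field_simp

/-- A strong law of large numbers: the averages of a bounded sequence whose members at distance at
least `L` are orthogonal converge to `0` almost surely. -/
lemma ae_tendsto_average_of_orthogonal {Ω : Type*} [MeasurableSpace Ω] {μ : Measure Ω}
    [IsProbabilityMeasure μ] {U : ℕ → Ω → ℝ} {C : ℝ} {L : ℕ} (hm : ∀ i, Measurable (U i))
    (hC : ∀ i ω, |U i ω| ≤ C) (horth : ∀ i j, i + L ≤ j → ∫ ω, U i ω * U j ω ∂μ = 0) :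
    ∀ᵐ ω ∂μ, Tendsto (fun n : ℕ => (∑ i ∈ Finset.range n, U i ω) / n) atTop (𝓝 0) := by
  set A : ℕ → Ω → ℝ := fun k ω => (∑ i ∈ Finset.range (k ^ 2), U i ω) / (k : ℝ) ^ 2 with hA
  set c : ℝ := (2 * L + 1) * C ^ 2 with hc
  have hc0 : 0 ≤ c := by positivity
  have hAm : ∀ k, Measurable (A k) := fun k =>
    (Finset.measurable_fun_sum _ fun i _ => hm i).div_const _
  have hAint : ∀ k, Integrable (fun ω => A k ω ^ 2) μ := fun k => by
    refine Integrable.of_bound ((hAm k).pow_const 2).aestronglyMeasurable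
      (((k ^ 2 : ℕ) * C / (k : ℝ) ^ 2) ^ 2) (Eventually.of_forall fun ω => ?_)
    rw [Real.norm_eq_abs, abs_pow, hA]
    dsimp only
    rw [abs_div, abs_of_nonneg (by positivity : (0 : ℝ) ≤ (k : ℝ) ^ 2)]
    gcongr
    calc _ ≤ ∑ i ∈ Finset.range (k ^ 2), |U i ω| := Finset.abs_sum_le_sum_abs _ _
      _ ≤ ∑ i ∈ Finset.range (k ^ 2), C := Finset.sum_le_sum fun i _ => hC i ω
      _ = _ := by simp
  have hAle : ∀ k, ∫ ω, A k ω ^ 2 ∂μ ≤ c / (k : ℝ) ^ 2 := fun k => by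
    have h := integral_sq_sum_le hm hC horth (k ^ 2)
    have h2 : ∫ ω, A k ω ^ 2 ∂μ
        = (∫ ω, (∑ i ∈ Finset.range (k ^ 2), U i ω) ^ 2 ∂μ) / ((k : ℝ) ^ 2) ^ 2 := by
      rw [← integral_div]
      simp only [hA, div_pow]
    rw [h2]
    rcases Nat.eq_zero_or_pos k with rfl | hk
    · simp
    · have hk' : (0 : ℝ) < k := by exact_mod_cast hk
      calc _ ≤ ((k ^ 2 : ℕ) * c) / ((k : ℝ) ^ 2) ^ 2 := by gcongr
        _ = _ := by push_cast; field_simp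
  have hsum : Summable fun k : ℕ => c / (k : ℝ) ^ 2 := by
    simpa [div_eq_mul_inv] using (Real.summable_nat_pow_inv.2 one_lt_two).mul_left c
  -- The second moments along squares are summable, so `∑ A k ^ 2` has finite expectation and is
  -- almost surely finite; its terms then tend to zero.
  have hfin : ∫⁻ ω, ∑' k, ENNReal.ofReal (A k ω ^ 2) ∂μ ≠ ⊤ := by
    rw [lintegral_tsum fun k => ((hAm k).pow_const 2).ennreal_ofReal.aemeasurable]
    refine ne_top_of_le_ne_top hsum.tsum_ofReal_ne_top (ENNReal.tsum_le_tsum fun k => ?_)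
    rw [← ofReal_integral_eq_lintegral_ofReal (hAint k) (Eventually.of_forall fun _ => sq_nonneg _)]
    exact ENNReal.ofReal_le_ofReal (hAle k)
  have hmt : Measurable fun ω => ∑' k, ENNReal.ofReal (A k ω ^ 2) :=
    Measurable.tsum fun k => ((hAm k).pow_const 2).ennreal_ofReal
  filter_upwards [ae_lt_top hmt hfin] with ω hω
  refine tendsto_average_of_squares (fun i => hC i ω) ?_
  have h1 := ENNReal.tendsto_atTop_zero_of_tsum_ne_top hω.ne
  have h2 : Tendsto (fun k => A k ω ^ 2) atTop (𝓝 0) := by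
    have := (ENNReal.tendsto_toReal ENNReal.zero_ne_top).comp h1
    simpa [Function.comp_def, ENNReal.toReal_ofReal (sq_nonneg _)] using this
  have h3 := h2.sqrt
  simp only [Real.sqrt_sq_eq_abs, Real.sqrt_zero] at h3
  exact (tendsto_zero_iff_abs_tendsto_zero _).2 h3

/-! ### Functions of finite paths and the Markov property -/

/-- The random variable `ψ` is a function of the first `j + 1` values of the process `X`. -/
def DeterminedUpTo {Ω E : Type*} (X : ℕ → Ω → E) (j : ℕ) (ψ : Ω → ℝ) : Prop :=
  ∀ ω ω', (∀ t ≤ j, X t ω = X t ω') → ψ ω = ψ ω'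

section DeterminedUpTo

variable {Ω E : Type*} {X : ℕ → Ω → E} {j : ℕ} {ψ φ : Ω → ℝ}

lemma DeterminedUpTo.mono {k : ℕ} (h : DeterminedUpTo X j ψ) (hjk : j ≤ k) :
    DeterminedUpTo X k ψ :=
  fun ω ω' hX => h ω ω' fun t ht => hX t (ht.trans hjk)

lemma DeterminedUpTo.mul (h : DeterminedUpTo X j ψ) (h' : DeterminedUpTo X j φ) :
    DeterminedUpTo X j fun ω => ψ ω * φ ω :=
  fun ω ω' hX => by simp only [h ω ω' hX, h' ω ω' hX]

lemma DeterminedUpTo.sub (h : DeterminedUpTo X j ψ) (h' : DeterminedUpTo X j φ) :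
    DeterminedUpTo X j fun ω => ψ ω - φ ω :=
  fun ω ω' hX => by simp only [h ω ω' hX, h' ω ω' hX]

lemma determinedUpTo_comp (g : E → ℝ) : DeterminedUpTo X j fun ω => g (X j ω) :=
  fun ω ω' hX => by simp only [hX j le_rfl]

/-- The first `j + 1` values of a process. -/
def initialPath (X : ℕ → Ω → E) (j : ℕ) (ω : Ω) : Fin (j + 1) → E := fun t => X t ω

/-- Over a finite `E` there are finitely many initial paths, so measurability, integrability and
integrals of `ψ` reduce to finite sums. The default `0` is only taken off the range of `initialPath`
and is never seen. -/
lemma DeterminedUpTo.exists_eq (h : DeterminedUpTo X j ψ) :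
    ∃ Ψ : (Fin (j + 1) → E) → ℝ, ∀ ω, ψ ω = Ψ (initialPath X j ω) := by
  have hf : Function.FactorsThrough ψ (initialPath X j) := fun ω ω' hX =>
    h ω ω' fun t ht => congrFun hX ⟨t, Nat.lt_succ_of_le ht⟩
  exact ⟨Function.extend (initialPath X j) ψ 0, fun ω => (hf.extend_apply 0 ω).symm⟩

open Classical in
lemma comp_eq_sum_indicator {G : Type*} [Fintype G] (Y : Ω → G) (φ : G → ℝ) (ω : Ω) :
    φ (Y ω) = ∑ y, Set.indicator {ω | Y ω = y} (fun _ => φ y) ω := by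
  simp [Set.indicator_apply]

variable [MeasurableSpace Ω]

lemma measurableSet_initialPath (hX : ∀ t y, MeasurableSet {ω | X t ω = y})
    (q : Fin (j + 1) → E) : MeasurableSet {ω | initialPath X j ω = q} := by
  have h : {ω | initialPath X j ω = q} = ⋂ t : Fin (j + 1), {ω | X t ω = q t} := by
    ext ω
    simp [initialPath, funext_iff]
  rw [h]
  exact MeasurableSet.iInter fun t => hX t (q t)

lemma measurable_comp_of_finite {G : Type*} [Fintype G] {Y : Ω → G}
    (hY : ∀ y, MeasurableSet {ω | Y ω = y}) (φ : G → ℝ) : Measurable fun ω => φ (Y ω) := by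
  simp_rw [comp_eq_sum_indicator Y φ]
  exact Finset.measurable_fun_sum _ fun y _ => measurable_const.indicator (hY y)

lemma integrable_comp_of_finite {G : Type*} [Fintype G] {μ : Measure Ω} [IsFiniteMeasure μ]
    {Y : Ω → G} (hY : ∀ y, MeasurableSet {ω | Y ω = y}) (φ : G → ℝ) :
    Integrable (fun ω => φ (Y ω)) μ := by
  simp_rw [comp_eq_sum_indicator Y φ]
  exact integrable_finsetSum _ fun y _ => (integrable_const _).indicator (hY y)

lemma integral_comp_of_finite {G : Type*} [Fintype G] {μ : Measure Ω} [IsFiniteMeasure μ]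
    {Y : Ω → G} (hY : ∀ y, MeasurableSet {ω | Y ω = y}) (φ : G → ℝ) :
    ∫ ω, φ (Y ω) ∂μ = ∑ y, μ.real {ω | Y ω = y} * φ y := by
  simp_rw [comp_eq_sum_indicator Y φ]
  rw [integral_finsetSum _ fun y _ => (integrable_const _).indicator (hY y)]
  exact Finset.sum_congr rfl fun y _ => by rw [integral_indicator_const _ (hY y), smul_eq_mul]

variable [Fintype E]

lemma DeterminedUpTo.measurable (h : DeterminedUpTo X j ψ)
    (hX : ∀ t y, MeasurableSet {ω | X t ω = y}) : Measurable ψ := by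
  classical
  obtain ⟨Ψ, hΨ⟩ := h.exists_eq
  rw [funext hΨ]
  exact measurable_comp_of_finite (measurableSet_initialPath hX) Ψ

lemma DeterminedUpTo.integrable {μ : Measure Ω} [IsFiniteMeasure μ] (h : DeterminedUpTo X j ψ)
    (hX : ∀ t y, MeasurableSet {ω | X t ω = y}) : Integrable ψ μ := by
  classical
  obtain ⟨Ψ, hΨ⟩ := h.exists_eq
  rw [funext hΨ]
  exact integrable_comp_of_finite (measurableSet_initialPath hX) Ψ

/-- The one-step Markov property in integrated form, from the probabilities of finite paths. -/
lemma DeterminedUpTo.integral_mul_next {μ : Measure Ω} [IsFiniteMeasure μ]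
    (h : DeterminedUpTo X j ψ) (hX : ∀ t y, MeasurableSet {ω | X t ω = y}) (K : E → E → ℝ)
    (hK : ∀ q : ℕ → E, μ.real {ω | ∀ t ≤ j + 1, X t ω = q t}
      = μ.real {ω | ∀ t ≤ j, X t ω = q t} * K (q j) (q (j + 1))) (g : E → ℝ) :
    ∫ ω, ψ ω * g (X (j + 1) ω) ∂μ = ∫ ω, ψ ω * ∑ y, K (X j ω) y * g y ∂μ := by
  classical
  obtain ⟨Ψ, hΨ⟩ := h.exists_eq
  have hY : ∀ y : (Fin (j + 1) → E) × E,
      MeasurableSet {ω | (initialPath X j ω, X (j + 1) ω) = y} := fun y => by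
    have : {ω | (initialPath X j ω, X (j + 1) ω) = y}
        = {ω | initialPath X j ω = y.1} ∩ {ω | X (j + 1) ω = y.2} := by
      ext ω; simp [Prod.ext_iff]
    rw [this]
    exact (measurableSet_initialPath hX y.1).inter (hX _ _)
  have hleft := integral_comp_of_finite (μ := μ) hY fun y => Ψ y.1 * g y.2
  have hright := integral_comp_of_finite (μ := μ) (measurableSet_initialPath (j := j) hX)
    fun q => Ψ q * ∑ y, K (q (Fin.last j)) y * g y
  have hlast : ∀ ω, initialPath X j ω (Fin.last j) = X j ω := fun ω => rfl
  simp only [hlast] at hright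
  simp only [hΨ]
  rw [hleft, hright, Fintype.sum_prod_type]
  refine Finset.sum_congr rfl fun q _ => ?_
  rw [Finset.mul_sum, Finset.mul_sum]
  refine Finset.sum_congr rfl fun y _ => ?_
  -- `hK` speaks of infinite sequences, so the finite path is prolonged by the constant `y`; only
  -- entries up to `j + 1` matter.
  let r : ℕ → E := fun t => if ht : t < j + 1 then q ⟨t, ht⟩ else y
  have hr : ∀ ω, initialPath X j ω = q ↔ ∀ t ≤ j, X t ω = r t := fun ω => by
    constructor
    · rintro rfl t ht
      simp only [r, dif_pos (Nat.lt_succ_of_le ht), initialPath]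
    · intro H
      ext ⟨t, ht⟩
      have h := H t (Nat.le_of_lt_succ ht)
      simp only [r, dif_pos ht] at h
      exact h
  have hr1 : r (j + 1) = y := by simp [r]
  have hrj : r j = q (Fin.last j) := by simp [r, Fin.last]
  have h1 : {ω | (initialPath X j ω, X (j + 1) ω) = (q, y)} = {ω | ∀ t ≤ j + 1, X t ω = r t} := by
    ext ω
    simp only [Set.mem_ofPred_eq, Prod.mk.injEq, hr, Nat.le_succ_iff, Nat.succ_eq_add_one]
    constructor
    · rintro ⟨h, h'⟩ t (ht | rfl)
      exacts [h t ht, h'.trans hr1.symm]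
    · exact fun h => ⟨fun t ht => h t (Or.inl ht), (h _ (Or.inr rfl)).trans hr1⟩
  have h2 : {ω | initialPath X j ω = q} = {ω | ∀ t ≤ j, X t ω = r t} := Set.ext hr
  rw [h1, h2, hK r, hr1, hrj]
  ring

end DeterminedUpTo

/-! ### Window statistics of a finite Markov chain -/

/-- The product of the values of the functions in `l` along the data from time `i` on. -/
def windowProd {Z : Type*} (D : ℕ → Z) : List (Z → ℝ) → ℕ → ℝ
  | [], _ => 1
  | f :: l, i => f (D i) * windowProd D l (i + 1)

lemma exists_windowProd_bound {Z : Type*} [Fintype Z] (l : List (Z → ℝ)) :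
    ∃ C, ∀ (D : ℕ → Z) i, |windowProd D l i| ≤ C := by
  induction l with
  | nil => exact ⟨1, fun D i => by simp [windowProd]⟩
  | cons f l ih =>
    obtain ⟨C, hC⟩ := ih
    refine ⟨(∑ z, |f z|) * C, fun D i => ?_⟩
    rw [windowProd, abs_mul]
    exact mul_le_mul (Finset.single_le_sum (f := fun z => |f z|) (fun z _ => abs_nonneg _)
      (Finset.mem_univ _)) (hC D _) (abs_nonneg _) (Finset.sum_nonneg fun _ _ => abs_nonneg _)

lemma determinedUpTo_windowProd {Ω E Z : Type*} {X : ℕ → Ω → E} (d : E → Z) (l : List (Z → ℝ))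
    {i j : ℕ} (h : i + l.length ≤ j + 1) :
    DeterminedUpTo X j fun ω => windowProd (fun t => d (X t ω)) l i := by
  induction l generalizing i with
  | nil => exact fun _ _ _ => rfl
  | cons f l ih =>
    rw [List.length_cons] at h
    refine DeterminedUpTo.mul ?_ (ih (by omega))
    exact (determinedUpTo_comp fun x => f (d x)).mono (by omega)

/-- The mean of `windowProd` for a Markov chain with kernel `K` that is at `x` when the window
starts. -/
def windowMean {E Z : Type*} [Fintype E] (K : E → E → ℝ) (d : E → Z) : List (Z → ℝ) → E → ℝ
  | [], _ => 1
  | f :: l, x => f (d x) * ∑ y, K x y * windowMean K d l y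

/-- The first factor of the window is absorbed into the weight `ψ`, which is why `ψ` and `j` vary in
the induction; a one-step Markov property then turns the mean at time `j + 1` into a kernel average
at time `j`. -/
lemma DeterminedUpTo.integral_mul_windowProd {Ω E Z : Type*} [Fintype E] [MeasurableSpace Ω]
    {X : ℕ → Ω → E} {ψ : Ω → ℝ} {j : ℕ} {μ : Measure Ω} [IsFiniteMeasure μ]
    (h : DeterminedUpTo X j ψ) (hX : ∀ t y, MeasurableSet {ω | X t ω = y}) (K : E → E → ℝ)
    (hK : ∀ (j : ℕ) (q : ℕ → E), μ.real {ω | ∀ t ≤ j + 1, X t ω = q t}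
      = μ.real {ω | ∀ t ≤ j, X t ω = q t} * K (q j) (q (j + 1))) (d : E → Z)
    (l : List (Z → ℝ)) :
    ∫ ω, ψ ω * windowProd (fun t => d (X t ω)) l j ∂μ
      = ∫ ω, ψ ω * windowMean K d l (X j ω) ∂μ := by
  induction l generalizing ψ j with
  | nil => rfl
  | cons f l ih =>
    have h1 : DeterminedUpTo X j fun ω => ψ ω * f (d (X j ω)) :=
      h.mul (determinedUpTo_comp fun x => f (d x))
    simp only [windowProd, windowMean, ← mul_assoc]
    rw [ih (h1.mono j.le_succ), h1.integral_mul_next hX K (hK j)]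

/-- The ergodic theorem for window statistics of a finite Markov chain, started anywhere, given a
solution of the Poisson equation for the mean of the window. -/
lemma ae_tendsto_average_windowProd {Ω E Z : Type*} [Fintype E] [Fintype Z] [MeasurableSpace Ω]
    {X : ℕ → Ω → E} {μ : Measure Ω} [IsProbabilityMeasure μ]
    (hX : ∀ t y, MeasurableSet {ω | X t ω = y}) (K : E → E → ℝ)
    (hK : ∀ (j : ℕ) (q : ℕ → E), μ.real {ω | ∀ t ≤ j + 1, X t ω = q t}
      = μ.real {ω | ∀ t ≤ j, X t ω = q t} * K (q j) (q (j + 1))) (d : E → Z)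
    (l : List (Z → ℝ)) {c : ℝ} {g : E → ℝ}
    (hg : ∀ x, windowMean K d l x - c = g x - ∑ y, K x y * g y) :
    ∀ᵐ ω ∂μ, Tendsto (fun n : ℕ =>
      (∑ i ∈ Finset.range n, windowProd (fun t => d (X t ω)) l i) / n) atTop (𝓝 c) := by
  have hbound : ∀ φ : E → ℝ, ∃ C, ∀ x, |φ x| ≤ C := fun φ =>
    ⟨∑ x, |φ x|, fun x => Finset.single_le_sum (f := fun x => |φ x|) (fun _ _ => abs_nonneg _)
      (Finset.mem_univ x)⟩
  obtain ⟨C₁, hC₁⟩ := exists_windowProd_bound l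
  obtain ⟨C₂, hC₂⟩ := hbound (windowMean K d l)
  obtain ⟨C₃, hC₃⟩ := hbound g
  obtain ⟨C₄, hC₄⟩ := hbound fun x => ∑ y, K x y * g y
  set U : ℕ → Ω → ℝ := fun i ω =>
    windowProd (fun t => d (X t ω)) l i - windowMean K d l (X i ω) with hU
  set V : ℕ → Ω → ℝ := fun i ω => g (X (i + 1) ω) - ∑ y, K (X i ω) y * g y with hV
  have hUdet : ∀ {i j}, i + l.length ≤ j → DeterminedUpTo X j (U i) := fun {i j} h =>
    (determinedUpTo_windowProd d l (by omega)).sub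
      ((determinedUpTo_comp (windowMean K d l)).mono (by omega))
  have hVdet : ∀ {i j}, i + 1 ≤ j → DeterminedUpTo X j (V i) := fun {i j} h =>
    ((determinedUpTo_comp g).mono h).sub
      ((determinedUpTo_comp fun x => ∑ y, K x y * g y).mono (by omega))
  have hUlim := ae_tendsto_average_of_orthogonal (μ := μ) (U := U) (C := C₁ + C₂) (L := l.length)
    (fun i => (hUdet le_rfl).measurable hX)
    (fun i ω => (abs_sub _ _).trans (add_le_add (hC₁ _ _) (hC₂ _)))
    -- By time `j` the window started at `i` is complete, so `U i` is a weight against which the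
    -- window at `j` may be replaced by its conditional mean.
    (fun i j h => by
      have hd := hUdet h
      have hd1 := (hd.mono (Nat.le_add_right j l.length)).mul
        (determinedUpTo_windowProd (X := X) d l (i := j) (j := j + l.length) (by omega))
      have hd2 := hd.mul (determinedUpTo_comp (X := X) (windowMean K d l))
      simp only [hU, mul_sub] at hd1 hd2 ⊢
      rw [integral_sub (hd1.integrable hX) (hd2.integrable hX), sub_eq_zero]
      exact hd.integral_mul_windowProd hX K hK d l)
  have hVlim := ae_tendsto_average_of_orthogonal (μ := μ) (U := V) (C := C₃ + C₄) (L := 1)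
    (fun i => (hVdet le_rfl).measurable hX)
    (fun i ω => (abs_sub _ _).trans (add_le_add (hC₃ _) (hC₄ _)))
    (fun i j h => by
      have hd := hVdet h
      have hd1 := (hd.mono j.le_succ).mul (determinedUpTo_comp (X := X) g)
      have hd2 := hd.mul (determinedUpTo_comp (X := X) fun x => ∑ y, K x y * g y)
      simp only [hV, mul_sub] at hd1 hd2 ⊢
      rw [integral_sub (hd1.integrable hX) (hd2.integrable hX), sub_eq_zero]
      exact hd.integral_mul_next hX K (hK j) g)
  filter_upwards [hUlim, hVlim] with ω hUω hVω
  have htel : Tendsto (fun n : ℕ => (g (X 0 ω) - g (X n ω)) / n) atTop (𝓝 0) := by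
    refine squeeze_zero_norm (fun n => ?_) (tendsto_const_div_atTop_nhds_zero_nat (C₃ + C₃))
    rw [Real.norm_eq_abs, abs_div, Nat.abs_cast]
    gcongr
    exact (abs_sub _ _).trans (add_le_add (hC₃ _) (hC₃ _))
  have hlim := ((hUω.add hVω).add htel).add (tendsto_const_nhds (x := c))
  simp only [zero_add] at hlim
  refine hlim.congr' ?_
  filter_upwards [eventually_ge_atTop 1] with n hn
  have hn0 : (n : ℝ) ≠ 0 := by
    have : n ≠ 0 := by omega
    exact_mod_cast this
  -- Termwise, the Poisson equation writes `windowMean - c` as `V i` plus the telescoping increment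
  -- `g (X i) - g (X (i + 1))`.
  have hsum : ∑ i ∈ Finset.range n, windowProd (fun t => d (X t ω)) l i
      = ∑ i ∈ Finset.range n, U i ω + ∑ i ∈ Finset.range n, V i ω + (g (X 0 ω) - g (X n ω))
        + n * c := by
    rw [← Finset.sum_range_sub' fun i => g (X i ω), ← Finset.sum_add_distrib,
      ← Finset.sum_add_distrib]
    have : (n : ℝ) * c = ∑ i ∈ Finset.range n, c := by simp
    rw [this, ← Finset.sum_add_distrib]
    refine Finset.sum_congr rfl fun i _ => ?_
    have := hg (X i ω)
    simp only [hU, hV]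
    linarith
  rw [hsum]
  field_simp

/-! ### Occurrences of strings as window products -/

lemma window_succ {A O : Type*} (D : ℕ → A × O) (i L : ℕ) :
    window D i (L + 1) = D i :: window D (i + 1) L := by
  simp only [window, List.range_succ_eq_map, List.map_cons, List.map_map, Nat.add_zero]
  congr 2
  ext j : 1
  simp only [Function.comp_apply]
  congr 1
  omega

open Classical in
/-- The indicator functions of the members of a string. -/
noncomputable def stringIndicators {A O : Type*} (w : List (A × O)) : List (A × O → ℝ) :=
  w.map fun x z => if z = x then 1 else 0

open Classical in
/-- The indicator functions of the actions of a string. -/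
noncomputable def actionIndicators {A O : Type*} (w : List (A × O)) : List (A × O → ℝ) :=
  w.map fun x z => if z.1 = x.1 then 1 else 0

open Classical in
lemma windowProd_stringIndicators {A O : Type*} (D : ℕ → A × O) (w : List (A × O)) (i : ℕ) :
    windowProd D (stringIndicators w) i = if window D i w.length = w then 1 else 0 := by
  induction w generalizing i with
  | nil => simp [stringIndicators, windowProd, window]
  | cons x w ih =>
    have h : windowProd D (stringIndicators (x :: w)) i
        = (if D i = x then 1 else 0) * windowProd D (stringIndicators w) (i + 1) := rfl
    rw [h, ih, List.length_cons, window_succ]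
    by_cases h1 : D i = x <;> simp [h1]

open Classical in
lemma windowProd_actionIndicators {A O : Type*} (D : ℕ → A × O) (w : List (A × O)) (i : ℕ) :
    windowProd D (actionIndicators w) i
      = if (window D i w.length).map Prod.fst = w.map Prod.fst then 1 else 0 := by
  induction w generalizing i with
  | nil => simp [actionIndicators, windowProd, window]
  | cons x w ih =>
    have h : windowProd D (actionIndicators (x :: w)) i
        = (if (D i).1 = x.1 then 1 else 0) * windowProd D (actionIndicators w) (i + 1) := rfl
    rw [h, ih, List.length_cons, window_succ]
    by_cases h1 : (D i).1 = x.1 <;> simp [h1]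

/-! ### The induced chain, its stationary law and the Hankel entries -/

namespace POMDP

variable {S A O : Type*} [Fintype S] [Fintype A] [Fintype O]

/-- The transition kernel of the induced chain on all triples. -/
noncomputable def kernel (P : POMDP S A O) (x y : S × A × O) : ℝ :=
  P.T x.2.1 x.1 y.1 * ((Fintype.card A : ℝ)⁻¹ * P.Obs y.2.1 y.1 y.2.2)

/-- The kernel gives no mass to triples outside `ChainState`. This allows working with a process in
all of `S × A × O`. -/
lemma sum_kernel_mul (P : POMDP S A O) (x : S × A × O) (g : S × A × O → ℝ) :
    ∑ y, P.kernel x y * g y = ∑ y : P.ChainState, P.kernel x y.1 * g y.1 := by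
  have h := P.sum_chainState fun i a z =>
    P.T x.2.1 x.1 i * (Fintype.card A : ℝ)⁻¹ * g (i, a, z)
  simp only [Fintype.sum_prod_type, kernel]
  calc _ = ∑ i, ∑ a, ∑ z, P.T x.2.1 x.1 i * (Fintype.card A : ℝ)⁻¹ * g (i, a, z)
        * P.Obs a i z := by
        refine Finset.sum_congr rfl fun i _ => Finset.sum_congr rfl fun a _ =>
          Finset.sum_congr rfl fun z _ => by ring
    _ = _ := h.symm
    _ = _ := Finset.sum_congr rfl fun y _ => by simp only [Prod.mk.eta]; ring

/-- The Poisson equation of the induced chain, on all triples. -/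
lemma exists_poisson [Nonempty A] (P : POMDP S A O) (hP : P.chainMatrix.IsIrreducible)
    {p : P.ChainState → ℝ} (hp : P.IsStationary p) {f : S × A × O → ℝ}
    (hf : ∑ x : P.ChainState, p x * f x.1 = 0) :
    ∃ g : S × A × O → ℝ, ∀ x, f x = g x - ∑ y, P.kernel x y * g y := by
  classical
  obtain ⟨G, hG⟩ := hP.exists_poisson P.chainMatrix_row_sum hp.1.2 hp.2 (f := fun x => f x.1) hf
  -- No triple leads into a forbidden one, so the values of `g` there enter no sum and can be chosen
  -- to satisfy the equation. It thus holds at every triple, without exceptional paths.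
  refine ⟨fun x => if h : 0 < P.Obs x.2.1 x.1 x.2.2 then G ⟨x, h⟩
    else f x + ∑ y : P.ChainState, P.kernel x y.1 * G y, fun x => ?_⟩
  have hsum : ∀ y : P.ChainState, (if h : 0 < P.Obs y.1.2.1 y.1.1 y.1.2.2 then G ⟨y.1, h⟩
      else f y.1 + ∑ z : P.ChainState, P.kernel y.1 z.1 * G z) = G y := fun y => dif_pos y.2
  rw [sum_kernel_mul]
  simp only [hsum]
  split_ifs with h
  · exact congrFun hG ⟨x, h⟩
  · ring

lemma isStationary_iff [Nonempty A] (P : POMDP S A O) (hP : P.chainMatrix.IsIrreducible)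
    (p : P.ChainState → ℝ) : P.IsStationary p ↔ p = P.stationaryDist := by
  have hs : P.IsStationary P.stationaryDist := P.exists_isStationary.choose_spec
  refine ⟨fun hp => ?_, fun h => h ▸ hs⟩
  exact hP.stationary_unique P.chainMatrix_row_sum hs.1.2 hs.2 hp.1.2 hp.2

/-- The mean of a function of a uniform action and the observation emitted in the state `i`. -/
noncomputable def emissionMean (P : POMDP S A O) (f : A → O → ℝ) (i : S) : ℝ :=
  ∑ a, ∑ z, (Fintype.card A : ℝ)⁻¹ * P.Obs a i z * f a z

lemma emissionMean_one [Nonempty A] (P : POMDP S A O) (i : S) :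
    P.emissionMean (fun _ _ => 1) i = 1 := by
  simp [emissionMean, ← Finset.mul_sum, (P.Obs_mem _ _).2]

lemma sum_kernel_mul_eq (P : POMDP S A O) (x : S × A × O) (g : S × A × O → ℝ) :
    ∑ y, P.kernel x y * g y
      = ∑ i, P.T x.2.1 x.1 i * P.emissionMean (fun a z => g (i, a, z)) i := by
  simp only [Fintype.sum_prod_type, kernel, emissionMean, Finset.mul_sum, mul_assoc]

/-- In a stationary distribution action and observation are drawn afresh given the state. -/
lemma IsStationary.apply_eq [Nonempty A] {P : POMDP S A O} {p : P.ChainState → ℝ}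
    (hp : P.IsStationary p) (y : P.ChainState) :
    p y = P.stateMarginal p y.1.1 * ((Fintype.card A : ℝ)⁻¹ * P.Obs y.1.2.1 y.1.1 y.1.2.2) := by
  classical
  have hstep : ∀ y, p y = ∑ x, p x * P.kernel x.1 y.1 := fun y => (congrFun hp.2 y).symm
  have hmarg : ∀ i, P.stateMarginal p i = ∑ x, p x * P.T x.1.2.1 x.1.1 i := fun i => by
    calc P.stateMarginal p i = ∑ y : P.ChainState, p y * if y.1.1 = i then 1 else 0 := by
          simp only [stateMarginal, mul_ite, mul_one, mul_zero]
      _ = ∑ y : P.ChainState, ∑ x, p x * P.kernel x.1 y.1 * if y.1.1 = i then 1 else 0 :=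
          Finset.sum_congr rfl fun y _ => by rw [hstep y, Finset.sum_mul]
      _ = ∑ x, p x * ∑ y : P.ChainState, P.kernel x.1 y.1 * if y.1.1 = i then 1 else 0 := by
          rw [Finset.sum_comm]
          simp only [Finset.mul_sum, mul_assoc]
      _ = _ := Finset.sum_congr rfl fun x _ => by
          rw [← P.sum_kernel_mul x.1 fun y => if y.1 = i then 1 else 0, sum_kernel_mul_eq]
          congr 1
          rw [Finset.sum_eq_single i]
          · simp [emissionMean_one]
          · intro k _ hk
            simp [hk, emissionMean]
          · simp
  rw [hstep y, hmarg, Finset.sum_mul]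
  exact Finset.sum_congr rfl fun x _ => by rw [kernel]; ring

lemma IsStationary.sum_mul_eq [Nonempty A] {P : POMDP S A O} {p : P.ChainState → ℝ}
    (hp : P.IsStationary p) (g : S × A × O → ℝ) :
    ∑ x : P.ChainState, p x * g x.1
      = ∑ i, P.stateMarginal p i * P.emissionMean (fun a z => g (i, a, z)) i := by
  have h := P.sum_chainState fun i a z =>
    P.stateMarginal p i * (Fintype.card A : ℝ)⁻¹ * g (i, a, z)
  calc _ = ∑ x : P.ChainState, P.stateMarginal p x.1.1 * (Fintype.card A : ℝ)⁻¹ * g x.1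
        * P.Obs x.1.2.1 x.1.1 x.1.2.2 := Finset.sum_congr rfl fun x _ => by
        rw [hp.apply_eq x]
        ring
    _ = _ := h
    _ = _ := Finset.sum_congr rfl fun i _ => by
        simp only [emissionMean, Finset.mul_sum]
        exact Finset.sum_congr rfl fun a _ => Finset.sum_congr rfl fun z _ => by ring

/-- Averaging out action and observation leaves a recursion over states alone, of the same shape as
`backward_cons`. -/
lemma emissionMean_windowMean_cons (P : POMDP S A O) (f : A × O → ℝ) (l : List (A × O → ℝ))
    (i : S) :
    P.emissionMean (fun a z => windowMean P.kernel Prod.snd (f :: l) (i, a, z)) i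
      = P.emissionMean (fun a z => f (a, z) * ∑ j, P.T a i j *
          P.emissionMean (fun a z => windowMean P.kernel Prod.snd l (j, a, z)) j) i := by
  simp only [windowMean, sum_kernel_mul_eq]

lemma backward_nil (P : POMDP S A O) (i : S) : P.backward i [] = 1 := by
  classical
  simp [backward, stringMatrix]

lemma backward_cons (P : POMDP S A O) (x : A × O) (w : List (A × O)) (i : S) :
    P.backward i (x :: w) = P.Obs x.1 i x.2 * ∑ j, P.T x.1 i j * P.backward j w := by
  classical
  simp only [backward, stringMatrix, List.map_cons, List.prod_cons, Matrix.of_apply, obsDiag]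
  rw [← Matrix.mulVec_mulVec, ← Matrix.mulVec_mulVec, Matrix.mulVec_diagonal]
  rfl

/-- Each step forces one action, at cost `|A|⁻¹`, and contributes the emission and transition
factors of `backward`. -/
lemma emissionMean_stringIndicators (P : POMDP S A O) [Nonempty A] (w : List (A × O)) (i : S) :
    P.emissionMean (fun a z => windowMean P.kernel Prod.snd (stringIndicators w) (i, a, z)) i
      = (Fintype.card A : ℝ)⁻¹ ^ w.length * P.backward i w := by
  classical
  induction w generalizing i with
  | nil => simpa [stringIndicators, windowMean, backward_nil] using P.emissionMean_one i
  | cons x w ih =>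
    have h : stringIndicators (x :: w)
        = (fun z => if z = x then 1 else 0) :: stringIndicators w := by
      simp only [stringIndicators, List.map_cons]
    rw [h, emissionMean_windowMean_cons, backward_cons, emissionMean]
    simp only [ih]
    rw [← Fintype.sum_prod_type' (f := fun a z => (Fintype.card A : ℝ)⁻¹ * P.Obs a i z *
      ((if (a, z) = x then 1 else 0) * ∑ j, P.T a i j *
        ((Fintype.card A : ℝ)⁻¹ ^ w.length * P.backward j w))), Finset.sum_eq_single x]
    · simp only [Prod.mk.eta, if_true, one_mul, List.length_cons, pow_succ, Finset.mul_sum]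
      exact Finset.sum_congr rfl fun j _ => by ring
    · intro y _ hy
      simp [hy]
    · simp

/-- With only the actions prescribed, observations and transitions sum to one. -/
lemma emissionMean_actionIndicators (P : POMDP S A O) [Nonempty A] (w : List (A × O)) (i : S) :
    P.emissionMean (fun a z => windowMean P.kernel Prod.snd (actionIndicators w) (i, a, z)) i
      = (Fintype.card A : ℝ)⁻¹ ^ w.length := by
  classical
  induction w generalizing i with
  | nil => simpa [actionIndicators, windowMean] using P.emissionMean_one i
  | cons x w ih =>
    have h : actionIndicators (x :: w)
        = (fun z => if z.1 = x.1 then 1 else 0) :: actionIndicators w := by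
      simp only [actionIndicators, List.map_cons]
    rw [h, emissionMean_windowMean_cons, emissionMean]
    simp only [ih, ← Finset.sum_mul, (P.T_mem _ _).2, one_mul]
    rw [Finset.sum_eq_single x.1]
    · simp only [if_true, one_mul, List.length_cons]
      rw [← Finset.sum_mul, ← Finset.mul_sum, (P.Obs_mem _ _).2, mul_one, pow_succ']
    · intro a _ ha
      simp [ha]
    · simp

/-- The string matrices multiply under concatenation, so an entry depends only on `hist ++ test`;
this is what lets one window count estimate it. -/
lemma hankel_apply (P : POMDP S A O) (hist test : List (A × O)) :
    P.hankel hist test = ∑ i, P.b₀ i * P.backward i (hist ++ test) := by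
  classical
  have h : P.hankel hist test
      = Matrix.vecMul P.b₀ (P.stringMatrix hist) ⬝ᵥ (P.stringMatrix test).mulVec 1 := rfl
  rw [h, ← Matrix.dotProduct_mulVec, Matrix.mulVec_mulVec]
  simp only [stringMatrix, ← List.prod_append, ← List.map_append]
  rfl

/-! ### Convergence of the estimate and the rank of its limit -/

/-- The law of a trajectory makes the triples a Markov chain with kernel `P.kernel`. -/
lemma IsTrajectory.real_path_succ {Ω : Type*} [MeasurableSpace Ω] {μ : Measure Ω}
    {P : POMDP S A O} {s : ℕ → Ω → S} {a : ℕ → Ω → A} {o : ℕ → Ω → O}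
    (h : P.IsTrajectory μ s a o) (j : ℕ) (q : ℕ → S × A × O) :
    μ.real {ω | ∀ t ≤ j + 1, (s t ω, a t ω, o t ω) = q t}
      = μ.real {ω | ∀ t ≤ j, (s t ω, a t ω, o t ω) = q t} * P.kernel (q j) (q (j + 1)) := by
  have hlaw := fun n => h.law n (fun t => (q t).1) (fun t => (q t).2.1) (fun t => (q t).2.2)
  simp only [Prod.ext_iff, hlaw]
  rw [Finset.prod_range_succ _ (j + 1), Finset.prod_range_succ _ j, kernel]
  rw [Finset.prod_range_succ _ j]
  ring

lemma IsTrajectory.measurableSet_triple {Ω : Type*} [MeasurableSpace Ω] {μ : Measure Ω}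
    {P : POMDP S A O} {s : ℕ → Ω → S} {a : ℕ → Ω → A} {o : ℕ → Ω → O}
    (h : P.IsTrajectory μ s a o) (t : ℕ) (y : S × A × O) :
    MeasurableSet {ω | (s t ω, a t ω, o t ω) = y} := by
  have hs : {ω | (s t ω, a t ω, o t ω) = y}
      = s t ⁻¹' {y.1} ∩ (a t ⁻¹' {y.2.1} ∩ o t ⁻¹' {y.2.2}) := by
    ext ω
    simp [Prod.ext_iff]
  rw [hs]
  exact (h.measurable_s t trivial).inter ((h.measurable_a t trivial).inter
    (h.measurable_o t trivial))

/-- Window statistics of the data converge to their stationary mean. -/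
lemma IsTrajectory.ae_tendsto_windowProd [Nonempty A] {Ω : Type*} [MeasurableSpace Ω]
    {μ : Measure Ω} [IsProbabilityMeasure μ] {P : POMDP S A O} {s : ℕ → Ω → S} {a : ℕ → Ω → A}
    {o : ℕ → Ω → O} (h : P.IsTrajectory μ s a o) (hP : P.chainMatrix.IsIrreducible)
    (l : List (A × O → ℝ)) :
    ∀ᵐ ω ∂μ, Tendsto (fun n : ℕ =>
      (∑ i ∈ Finset.range n, windowProd (fun t => (a t ω, o t ω)) l i) / n) atTop
      (𝓝 (∑ i, P.atStationarity.b₀ i *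
        P.emissionMean (fun a z => windowMean P.kernel Prod.snd l (i, a, z)) i)) := by
  have hp : P.IsStationary P.stationaryDist := P.exists_isStationary.choose_spec
  have hmean := hp.sum_mul_eq (windowMean P.kernel Prod.snd l)
  obtain ⟨g, hg⟩ := P.exists_poisson hP hp (f := fun x => windowMean P.kernel Prod.snd l x
      - ∑ x : P.ChainState, P.stationaryDist x * windowMean P.kernel Prod.snd l x.1) (by
    simp only [mul_sub, Finset.sum_sub_distrib, ← Finset.sum_mul, hp.1.2, one_mul, sub_self])
  have := ae_tendsto_average_windowProd (X := fun t ω => (s t ω, a t ω, o t ω))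
    h.measurableSet_triple P.kernel h.real_path_succ Prod.snd l hg
  rw [hmean] at this
  exact this

lemma IsTrajectory.ae_tendsto_empiricalHankel [Nonempty A] {Ω : Type*} [MeasurableSpace Ω]
    {μ : Measure Ω} [IsProbabilityMeasure μ] {P : POMDP S A O} {s : ℕ → Ω → S} {a : ℕ → Ω → A}
    {o : ℕ → Ω → O} (h : P.IsTrajectory μ s a o) (hP : P.chainMatrix.IsIrreducible) :
    ∀ᵐ ω ∂μ, Tendsto (fun n : ℕ => empiricalHankel (fun t => (a t ω, o t ω)) n) atTop
      (𝓝 P.atStationarity.hankel) := by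
  classical
  -- There are countably many strings, so one null set serves for all of them.
  have hnum := ae_all_iff.2 fun w : List (A × O) => h.ae_tendsto_windowProd hP (stringIndicators w)
  have hden := ae_all_iff.2 fun w : List (A × O) => h.ae_tendsto_windowProd hP (actionIndicators w)
  filter_upwards [hnum, hden] with ω hn hd
  refine tendsto_pi_nhds.2 fun hist => tendsto_pi_nhds.2 fun test => ?_
  set w := hist ++ test with hw
  have hκ : (Fintype.card A : ℝ)⁻¹ ^ w.length ≠ 0 := by simp
  have hd' := hd w
  have hn' := hn w
  simp only [emissionMean_actionIndicators, ← Finset.sum_mul, P.atStationarity.b₀_mem.2, one_mul]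
    at hd'
  simp only [emissionMean_stringIndicators] at hn'
  -- The estimate uses `n - L` windows, so the averages are reindexed; their common normalisation
  -- cancels once `n > L`.
  have hlim := (hn'.div hd' hκ).comp (tendsto_sub_atTop_nat w.length)
  have hval : (∑ i, P.atStationarity.b₀ i * ((Fintype.card A : ℝ)⁻¹ ^ w.length * P.backward i w))
      / (Fintype.card A : ℝ)⁻¹ ^ w.length = P.atStationarity.hankel hist test := by
    rw [hankel_apply, ← hw, Finset.sum_div]
    refine Finset.sum_congr rfl fun i _ => ?_
    -- The backward matrix does not involve the initial distribution.
    have hb : P.atStationarity.backward i w = P.backward i w := rfl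
    rw [hb]
    field_simp
  rw [hval] at hlim
  refine hlim.congr' ?_
  filter_upwards [eventually_gt_atTop w.length] with n hlt
  have hm : ((n - w.length : ℕ) : ℝ) ≠ 0 := by
    have : n - w.length ≠ 0 := by omega
    exact_mod_cast this
  simp only [Function.comp_apply, Pi.div_apply, empiricalHankel, Matrix.of_apply,
    windowProd_stringIndicators, windowProd_actionIndicators, ← hw]
  rw [div_div_div_cancel_right₀ hm]

lemma eRank_hankelUpTo (P : POMDP S A O) {N M : ℕ∞}
    (hF : (P.shortForward N).eRank = Fintype.card S)
    (hB : (P.backwardUpTo M).eRank = Fintype.card S) :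
    (P.hankelUpTo N M).eRank = Fintype.card S := by
  have hmul : P.hankelUpTo N M
      = P.forward.submatrix (Subtype.val : {w : List (A × O) // (w.length : ℕ∞) ≤ N} → _) id
        * P.backwardUpTo M := by
    ext
    rfl
  have hshort : P.shortForward N
      = (P.forward.submatrix (Subtype.val : {w : List (A × O) // (w.length : ℕ∞) ≤ N} → _)
        id).submatrix (Subtype.map id fun _ h => le_self_add.trans h) id := by
    ext
    rfl
  rw [hmul]
  generalize P.forward.submatrix (Subtype.val : {w : List (A × O) // (w.length : ℕ∞) ≤ N} → _) id
    = F at hshort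
  refine Matrix.eRank_mul_eq_card F _ (le_antisymm ?_ ?_) hB
  · simpa using F.eRank_le_card_width
  · rw [← hF, hshort]
    exact F.eRank_submatrix_le _ _

end POMDP

theorem lemma1 {S A O Ω : Type*} [Fintype S] [Fintype A] [Fintype O] [Nonempty A]
    [MeasurableSpace Ω] (μ : Measure Ω) [IsProbabilityMeasure μ]
    (P : POMDP S A O) (N M : ℕ∞)
    (hErg : P.IsErgodic)
    (hForward : (P.atStationarity.shortForward N).eRank = Fintype.card S)
    (hBackward : (P.backwardUpTo M).eRank = Fintype.card S)
    (s : ℕ → Ω → S) (a : ℕ → Ω → A) (o : ℕ → Ω → O)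
    (hTraj : P.IsTrajectory μ s a o) :
    (∀ p : P.ChainState → ℝ, P.IsStationary p ↔ p = P.stationaryDist) ∧
    (∀ᵐ ω ∂μ, Tendsto (fun n : ℕ => empiricalHankel (fun t => (a t ω, o t ω)) n) atTop
      (𝓝 P.atStationarity.hankel)) ∧
    (P.atStationarity.hankelUpTo N M).eRank = Fintype.card S := by
  exact ⟨P.isStationary_iff hErg.1, hTraj.ae_tendsto_empiricalHankel hErg.1,
    P.atStationarity.eRank_hankelUpTo hForward hBackward⟩
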